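/- For positive integers $a_1<\dots<a_n$ put $$M(a_1,\dots,a_n)=\max_{|z|=1}\prod_{j=1}^n|1-z^{a_j}|,\qquad F(\theta)=\sum_{j=1}^n\log|1-e(a_j\theta)|,\qquad e(x)=e^{2\pi i x}.$$ A finite set $D$ of integers is called dissociated if $\sum_{\nu\in D}\varepsilon_\nu\,\nu=0$ with all $\varepsilon_\nu\in\{0,1,-1\}$ implies that all $\varepsilon_\nu=0$. Let $\varepsilon>0$. (1) There is a constant $c=c(\varepsilon)>0$ such that, for all $n\ge 2$ and all positive integers $a_1<\dots<a_n$ for which $\{a_1,\dots,a_n\}$ contains a dissociated set of size $m$, $$\log M(a_1,\dots,a_n)\ \ge\ c\,\frac{m^{1/2-\varepsilon}}{(\log n)^{1/2}}\qquad\text{and}\qquad \int_0^1|F(\theta)|\,d\theta\ \ge\ c\,\frac{m^{1/2-\varepsilon}}{(\log n)^{1/2}}.$$ (2) For every $A>0$ there is a constant $C=C(\varepsilon,A)>0$ such that, for all $n\ge 2$ and all positive integers $a_1<\dots<a_n$ for which $\{a_1,\dots,a_n\}$ contains a dissociated set of size $m\ge C(\log n)^{3+\varepsilon}$, $$M(a_1,\dots,a_n)>\big(\sqrt{2n}\big)^{A}.$$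 In particular (1) then improves on the Erdős–Szekeres bound $M(a_1,\dots,a_n)\ge\sqrt{2n}$. -/

import Mathlib

namespace ErdosSzekeres

/-- `M(a₁, …, aₙ) = max_{|z| = 1} ∏ᵢ |1 - z ^ aᵢ|`; see `isGreatest_maxProd` for attainment. -/
noncomputable def maxProd {n : ℕ} (a : Fin n → ℕ) : ℝ :=
  sSup ((fun z : ℂ => ∏ i, ‖1 - z ^ a i‖) '' {z : ℂ | ‖z‖ = 1})

/-- The supremum defining `maxProd` is attained, i.e. it is a maximum. -/
theorem isGreatest_maxProd {n : ℕ} (a : Fin n → ℕ) :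
    IsGreatest ((fun z : ℂ => ∏ i, ‖1 - z ^ a i‖) '' {z : ℂ | ‖z‖ = 1}) (maxProd a) := by
  have hs : {z : ℂ | ‖z‖ = 1} = Metric.sphere (0 : ℂ) 1 := by
    ext z
    simp
  have hc : IsCompact {z : ℂ | ‖z‖ = 1} := hs ▸ isCompact_sphere (0 : ℂ) 1
  have hne : {z : ℂ | ‖z‖ = 1}.Nonempty := ⟨1, by simp⟩
  exact (hc.image (by fun_prop)).isGreatest_sSup (hne.image _)

/-- `e(x) = exp(2πix)`. -/
noncomputable def e (x : ℝ) : ℂ := Complex.exp (2 * Real.pi * Complex.I * x)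

/-- `F(θ) = ∑ⱼ log |1 - e(aⱼ θ)|` (the finitely many logarithmic singularities in `[0, 1]`
receive a finite value, which does not affect integrals). -/
noncomputable def logSum {n : ℕ} (a : Fin n → ℕ) (θ : ℝ) : ℝ :=
  ∑ j, Real.log ‖1 - e (a j * θ)‖

/-- A finite set of integers is dissociated if it admits no nontrivial relation with
coefficients `0, 1, -1`. -/
def IsDissociated (D : Finset ℤ) : Prop :=
  ∀ ε : ℤ → ℤ, (∀ d ∈ D, ε d = 0 ∨ ε d = 1 ∨ ε d = -1) →
    ∑ d ∈ D, ε d * d = 0 → ∀ d ∈ D, ε d = 0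

end ErdosSzekeres

/-!
# Lower bounds for `∏ |1 - z ^ a_j|` from dissociated frequencies

Write `F(θ) = ∑ log |1 - e(a_j θ)|`. The series `-log |1 - e(θ)| = ∑ cos (2πkθ) / k` has nonnegative
coefficients, so the coefficients of the dilates cannot cancel: for every frequency `ν = a_i` one has
`∫ -F(θ) cos (2πνθ) dθ ≥ 1/2` (`half_le_fourier_logSum`). The series is handled through
`log |1 - r e(θ)|` and dominated convergence as `r → 1`.

Let `D` be a dissociated set of `m` frequencies and `P(θ) = ∑_{ν ∈ D} cos (2πνθ)` (`cosSum`). Then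
`∫ -F P ≥ m / 2`. Since `exp (tx) ≤ cosh t + x sinh t` on `[-1, 1]`, the function `exp (tP)` is
dominated by a Riesz product, whose mean is `cosh(t) ^ m` because `D` is dissociated; hence
`∫ exp (tP) ≤ exp (m t² / 2)` (`IsDissociated.integral_exp_cosSum_le`). So `|P|` is at most
`L = C (m log n)^{1/2}` outside a set on which the trivial bounds, `|P| ≤ m` and the `L²` norm of
`log |1 - e(θ)|`, give a contribution below `m / 4` to the integral. On the rest `|F P| ≤ L |F|`, and
therefore `∫ |F| ≥ c (m / log n)^{1/2}` (`exists_le_integral_abs_logSum`), without loss of `m ^ ε`.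

Finally `∫ F = 0`, so `∫ |F| = 2 ∫ F⁺ ≤ 2 log M` (`integral_abs_logSum_le`). If
`m ≥ C (log n)^{3 + ε}` this makes `log M` exceed any given multiple of `log n`.
-/

open Real MeasureTheory Filter Topology

namespace ErdosSzekeres

/-! ### The character `e` and integrals of cosines -/

theorem continuous_e : Continuous e := by
  unfold e
  fun_prop

theorem e_eq_exp_I_mul (x : ℝ) : e x = Complex.exp (Complex.I * (2 * π * x : ℝ)) := by
  unfold e
  congr 1
  push_cast
  ring

theorem norm_e (x : ℝ) : ‖e x‖ = 1 := by
  rw [e_eq_exp_I_mul, mul_comm, Complex.norm_exp_ofReal_mul_I]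

theorem e_re (x : ℝ) : (e x).re = cos (2 * π * x) := by
  rw [e_eq_exp_I_mul, mul_comm, Complex.exp_ofReal_mul_I_re]

theorem e_pow (x : ℝ) (k : ℕ) : e x ^ k = e (k * x) := by
  unfold e
  rw [← Complex.exp_nat_mul]
  congr 1
  push_cast
  ring

theorem e_periodic : Function.Periodic e 1 := by
  intro x
  unfold e
  rw [Complex.exp_eq_exp_iff_exists_int]
  exact ⟨1, by push_cast; ring⟩

theorem e_eq_one_iff (x : ℝ) : e x = 1 ↔ ∃ n : ℤ, x = n := by
  unfold e
  rw [Complex.exp_eq_one_iff]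
  refine exists_congr fun n => ?_
  rw [show (2 * π * Complex.I * x : ℂ) = x * (2 * π * Complex.I) by ring,
    mul_left_inj' Complex.two_pi_I_ne_zero]
  norm_cast

/-- `∫₀¹ cos (2πkθ) dθ = 1` for `k = 0`, and `0` for other integers `k`. -/
theorem integral_cos_int (k : ℤ) :
    ∫ θ in (0 : ℝ)..1, cos (2 * π * (k * θ)) = if k = 0 then 1 else 0 := by
  split_ifs with hk
  · simp [hk]
  · have h : (2 * π * k : ℝ) ≠ 0 := by
      have : (k : ℝ) ≠ 0 := by exact_mod_cast hk
      positivity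
    have h2 : sin (2 * π * k) = 0 := by
      rw [show (2 * π * k : ℝ) = ((2 * k : ℤ) : ℝ) * π by push_cast; ring]
      exact sin_int_mul_pi _
    simp_rw [← mul_assoc]
    rw [intervalIntegral.integral_comp_mul_left (fun x => cos x) h]
    simp [h2]

theorem integral_cos_mul_cos (k l : ℤ) :
    ∫ θ in (0 : ℝ)..1, cos (2 * π * (k * θ)) * cos (2 * π * (l * θ)) =
      ((if k + l = 0 then 1 else 0) + (if k - l = 0 then 1 else 0)) / 2 := by
  have h : ∀ θ : ℝ, cos (2 * π * (k * θ)) * cos (2 * π * (l * θ)) =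
      (cos (2 * π * ((k + l : ℤ) * θ)) + cos (2 * π * ((k - l : ℤ) * θ))) / 2 := by
    intro θ
    push_cast
    rw [show 2 * π * ((k + l) * θ) = 2 * π * (k * θ) + 2 * π * (l * θ) by ring,
      show 2 * π * ((k - l) * θ) = 2 * π * (k * θ) - 2 * π * (l * θ) by ring, cos_add, cos_sub]
    ring
  simp_rw [h]
  rw [intervalIntegral.integral_div, intervalIntegral.integral_add, integral_cos_int,
    integral_cos_int]
  all_goals exact Continuous.intervalIntegrable (by fun_prop) _ _

/-! ### The function `log |1 - e(θ)|` -/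

/-- `log |1 - e(θ)|`, with the value `0` at the integers. -/
noncomputable def logKernel (θ : ℝ) : ℝ := Real.log ‖1 - e θ‖

theorem measurable_logKernel : Measurable logKernel := by
  have := continuous_e.measurable
  unfold logKernel
  fun_prop

theorem logKernel_periodic : Function.Periodic logKernel 1 := by
  intro x
  simp only [logKernel, e_periodic x]

theorem norm_one_sub_e_le (x : ℝ) : ‖1 - e x‖ ≤ 2 := by
  calc ‖1 - e x‖ ≤ ‖(1 : ℂ)‖ + ‖e x‖ := norm_sub_le _ _
    _ = 2 := by rw [norm_e, norm_one]; norm_num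

theorem le_norm_one_sub_e {x : ℝ} (h0 : 0 ≤ x) (h1 : x ≤ 1) :
    min x (1 - x) ≤ ‖1 - e x‖ := by
  have key : ∀ y : ℝ, 0 ≤ y → y ≤ 1 / 2 → y ≤ 2 * sin (π * y) := by
    intro y hy0 hy1
    have hπ := pi_pos
    have := mul_le_sin (x := π * y) (by positivity) (by nlinarith)
    have h2 : 2 / π * (π * y) = 2 * y := by field_simp
    rw [h2] at this
    linarith
  have hn : ‖1 - e x‖ = |2 * sin (π * x)| := by
    rw [norm_sub_rev, e_eq_exp_I_mul, Complex.norm_exp_I_mul_ofReal_sub_one, Real.norm_eq_abs]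
    congr 3
    ring
  rw [hn]
  rcases le_total x (1 / 2) with h | h
  · exact (min_le_left _ _).trans ((key x h0 h).trans (le_abs_self _))
  · have := key (1 - x) (by linarith) (by linarith)
    rw [show π * (1 - x) = π - π * x by ring, sin_pi_sub] at this
    exact (min_le_right _ _).trans (this.trans (le_abs_self _))

theorem logKernel_sq_le {x : ℝ} (h0 : 0 < x) (h1 : x < 1) :
    logKernel x ^ 2 ≤ 1 + 16 * (x ^ (-(1 / 2) : ℝ) + (1 - x) ^ (-(1 / 2) : ℝ)) := by
  have hx1 : 0 < 1 - x := by linarith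
  have hpx : 0 < x ^ (-(1 / 2) : ℝ) := rpow_pos_of_pos h0 _
  have hpx1 : 0 < (1 - x) ^ (-(1 / 2) : ℝ) := rpow_pos_of_pos hx1 _
  have hmin : 0 < min x (1 - x) := lt_min h0 hx1
  have hle := le_norm_one_sub_e h0.le h1.le
  have hpos : 0 < ‖1 - e x‖ := hmin.trans_le hle
  unfold logKernel
  set y := ‖1 - e x‖ with hy
  rcases le_total y 1 with hy1 | hy1
  · have hlog := abs_log_mul_self_rpow_lt y (1 / 4) hpos hy1 (by norm_num)
    have hyp : 0 < y ^ (1 / 4 : ℝ) := rpow_pos_of_pos hpos _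
    rw [abs_mul, abs_of_pos hyp] at hlog
    have hsq : log y ^ 2 * (y ^ (1 / 4 : ℝ)) ^ 2 ≤ 16 := by
      rw [← sq_abs, ← mul_pow]
      have : 0 ≤ |log y| * y ^ (1 / 4 : ℝ) := by positivity
      nlinarith
    have hhalf : (y ^ (1 / 4 : ℝ)) ^ 2 = y ^ (1 / 2 : ℝ) := by
      rw [← rpow_natCast, ← rpow_mul hpos.le]
      norm_num
    rw [hhalf] at hsq
    have h2 : log y ^ 2 ≤ 16 * y ^ (-(1 / 2) : ℝ) := by
      rw [rpow_neg hpos.le, ← div_eq_mul_inv, le_div_iff₀ (rpow_pos_of_pos hpos _)]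
      exact hsq
    have h3 : y ^ (-(1 / 2) : ℝ) ≤ (min x (1 - x)) ^ (-(1 / 2) : ℝ) :=
      rpow_le_rpow_of_nonpos hmin hle (by norm_num)
    have h4 : (min x (1 - x)) ^ (-(1 / 2) : ℝ) ≤
        x ^ (-(1 / 2) : ℝ) + (1 - x) ^ (-(1 / 2) : ℝ) := by
      rcases min_choice x (1 - x) with h | h <;> rw [h] <;> linarith
    linarith
  · have h2 : log y ≤ 1 := by
      have := log_le_sub_one_of_pos hpos
      have := norm_one_sub_e_le x
      linarith
    have h3 : 0 ≤ log y := log_nonneg hy1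
    nlinarith

theorem intervalIntegrable_logKernel_sq_unit :
    IntervalIntegrable (fun x => logKernel x ^ 2) volume 0 1 := by
  have h1 : IntervalIntegrable (fun x : ℝ => x ^ (-(1 / 2) : ℝ)) volume 0 1 :=
    intervalIntegral.intervalIntegrable_rpow' (by norm_num)
  have h2 : IntervalIntegrable (fun x : ℝ => (1 - x) ^ (-(1 / 2) : ℝ)) volume 0 1 := by
    have := h1.comp_sub_left 1
    simpa using this.symm
  have hb := (intervalIntegrable_const (μ := volume) (a := 0) (b := 1) (c := (1 : ℝ))).add
    ((h1.add h2).const_mul 16)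
  refine hb.mono_fun (measurable_logKernel.pow_const 2).aestronglyMeasurable ?_
  rw [Set.uIoc_of_le zero_le_one, ← restrict_Ioo_eq_restrict_Ioc]
  refine (ae_restrict_mem measurableSet_Ioo).mono fun x hx => ?_
  have := logKernel_sq_le hx.1 hx.2
  simp only [Real.norm_eq_abs, abs_of_nonneg (sq_nonneg (logKernel x))]
  exact this.trans (le_abs_self _)

theorem intervalIntegrable_logKernel_sq (s t : ℝ) :
    IntervalIntegrable (fun x => logKernel x ^ 2) volume s t :=
  (logKernel_periodic.comp (· ^ 2)).intervalIntegrable₀ one_ne_zero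
    intervalIntegrable_logKernel_sq_unit s t

theorem intervalIntegrable_logKernel_mul_sq (a : ℕ) :
    IntervalIntegrable (fun x => logKernel (a * x) ^ 2) volume 0 1 := by
  rcases Nat.eq_zero_or_pos a with rfl | ha
  · simp
  · have ha' : (a : ℝ) ≠ 0 := by positivity
    have := (intervalIntegrable_logKernel_sq 0 a).comp_mul_left (c := a)
    simpa [ha'] using this

/-- Dilating by a positive integer does not change the mean of a `1`-periodic function. -/
theorem integral_logKernel_mul_sq {a : ℕ} (ha : 0 < a) :
    ∫ x in (0 : ℝ)..1, logKernel (a * x) ^ 2 = ∫ x in (0 : ℝ)..1, logKernel x ^ 2 := by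
  have ha' : (a : ℝ) ≠ 0 := by positivity
  rw [intervalIntegral.integral_comp_mul_left (fun x => logKernel x ^ 2) ha']
  have := (logKernel_periodic.comp (· ^ 2)).intervalIntegral_add_zsmul_eq (a : ℤ) 0
    intervalIntegrable_logKernel_sq
  simp only [Function.comp_def, zero_add, zsmul_eq_mul, Int.cast_natCast, mul_one] at this
  simp [this, ha']

theorem intervalIntegrable_logKernel_mul (a : ℕ) :
    IntervalIntegrable (fun x => logKernel (a * x)) volume 0 1 := by
  have hb := (intervalIntegrable_const (μ := volume) (a := 0) (b := 1) (c := (1 : ℝ))).add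
    (intervalIntegrable_logKernel_mul_sq a)
  refine hb.mono_fun (measurable_logKernel.comp (measurable_const_mul _)).aestronglyMeasurable
    (ae_of_all _ fun x => ?_)
  simp only [Real.norm_eq_abs]
  refine le_trans ?_ (le_abs_self _)
  have h1 := sq_abs (logKernel (a * x))
  show |logKernel (a * x)| ≤ 1 + logKernel (a * x) ^ 2
  nlinarith [sq_nonneg (|logKernel (a * x)| - 1), abs_nonneg (logKernel (a * x))]

/-! ### Fourier coefficients of the logarithm -/

/-- For almost every `θ` none of the singularities of `log |1 - e(aθ)|` is hit. -/
theorem ae_e_mul_ne_one {a : ℕ} (ha : 0 < a) : ∀ᵐ θ : ℝ, e (a * θ) ≠ 1 := by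
  have hc : (Set.range fun n : ℤ => (n : ℝ) / a).Countable := Set.countable_range _
  filter_upwards [hc.ae_notMem volume] with θ hθ h
  obtain ⟨n, hn⟩ := (e_eq_one_iff _).1 h
  refine hθ ⟨n, ?_⟩
  have ha' : (a : ℝ) ≠ 0 := by positivity
  simp only [← hn]
  field_simp

theorem half_norm_one_sub_le {z : ℂ} (hz : ‖z‖ = 1) {r : ℝ} (hr0 : 0 ≤ r) (hr1 : r ≤ 1) :
    ‖1 - z‖ / 2 ≤ ‖1 - r * z‖ := by
  have h1 : ‖1 - z‖ ≤ ‖1 - r * z‖ + (1 - r) := by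
    calc ‖1 - z‖ = ‖(1 - r * z) - ((1 - r : ℝ) : ℂ) * z‖ := by congr 1; push_cast; ring
      _ ≤ ‖1 - r * z‖ + ‖((1 - r : ℝ) : ℂ) * z‖ := norm_sub_le _ _
      _ = _ := by rw [norm_mul, hz, mul_one, Complex.norm_real, Real.norm_eq_abs,
                    abs_of_nonneg (by linarith)]
  have h2 : 1 - r ≤ ‖1 - r * z‖ := by
    calc 1 - r = ‖(1 : ℂ)‖ - ‖(r : ℂ) * z‖ := by
          rw [norm_mul, hz, norm_one, Complex.norm_real, Real.norm_eq_abs, abs_of_nonneg hr0,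
            mul_one]
      _ ≤ _ := norm_sub_norm_le _ _
  linarith

theorem abs_log_norm_one_sub_le {z : ℂ} (hz : ‖z‖ = 1) (hz1 : z ≠ 1) {r : ℝ} (hr0 : 0 ≤ r)
    (hr1 : r ≤ 1) : |log ‖1 - r * z‖| ≤ log 2 + |log ‖1 - z‖| := by
  have hpos : 0 < ‖1 - z‖ := norm_pos_iff.2 (sub_ne_zero.2 hz1.symm)
  have h1 := half_norm_one_sub_le hz hr0 hr1
  have h2 : ‖1 - r * z‖ ≤ 2 := by
    calc ‖1 - r * z‖ ≤ ‖(1 : ℂ)‖ + ‖(r : ℂ) * z‖ := norm_sub_le _ _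
      _ ≤ 2 := by
        rw [norm_mul, hz, norm_one, Complex.norm_real, Real.norm_eq_abs, abs_of_nonneg hr0]
        linarith
  have h3 : log ‖1 - r * z‖ ≤ log 2 := log_le_log (by linarith) h2
  have h4 : log ‖1 - z‖ - log 2 ≤ log ‖1 - r * z‖ := by
    rw [← log_div hpos.ne' two_ne_zero]
    exact log_le_log (by linarith) h1
  rw [abs_le]
  constructor
  · have := neg_abs_le (log ‖1 - z‖)
    linarith
  · have := abs_nonneg (log ‖1 - z‖)
    linarith

theorem hasSum_log_norm_one_sub {r : ℝ} (hr0 : 0 ≤ r) (hr1 : r < 1) (x : ℝ) :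
    HasSum (fun k : ℕ => r ^ k / k * cos (2 * π * (k * x))) (-log ‖1 - r * e x‖) := by
  have hz : ‖(r : ℂ) * e x‖ < 1 := by
    rw [norm_mul, norm_e, Complex.norm_real, Real.norm_eq_abs, abs_of_nonneg hr0, mul_one]
    exact hr1
  have h := Complex.hasSum_re (Complex.hasSum_taylorSeries_neg_log hz)
  rw [Complex.neg_re, Complex.log_re] at h
  convert! h using 2 with k
  rw [Complex.div_natCast_re, mul_pow, e_pow, ← Complex.ofReal_pow, Complex.re_ofReal_mul, e_re]
  ring

theorem hasSum_integral_log_norm_one_sub {r : ℝ} (hr0 : 0 ≤ r) (hr1 : r < 1) (a l : ℕ) :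
    HasSum (fun k : ℕ => r ^ k / k * ∫ θ in (0 : ℝ)..1,
        cos (2 * π * ((k * a : ℤ) * θ)) * cos (2 * π * ((l : ℤ) * θ)))
      (∫ θ in (0 : ℝ)..1, -log ‖1 - r * e (a * θ)‖ * cos (2 * π * (l * θ))) := by
  have hs : Summable fun k : ℕ => r ^ k := summable_geometric_of_lt_one hr0 hr1
  simp_rw [← intervalIntegral.integral_const_mul]
  refine intervalIntegral.hasSum_integral_of_dominated_convergence (fun k _ => r ^ k) ?_ ?_ ?_ ?_ ?_
  · intro k
    exact Continuous.aestronglyMeasurable (by fun_prop)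
  · intro k
    refine ae_of_all _ fun θ _ => ?_
    rw [norm_mul, norm_mul, Real.norm_eq_abs, Real.norm_eq_abs, Real.norm_eq_abs]
    have h1 : |r ^ k / k| ≤ r ^ k := by
      rw [abs_of_nonneg (by positivity)]
      rcases Nat.eq_zero_or_pos k with rfl | hk
      · simp
      · exact div_le_self (by positivity) (by exact_mod_cast hk)
    calc _ ≤ r ^ k * (1 * 1) := by
          gcongr
          · exact abs_cos_le_one _
          · exact abs_cos_le_one _
      _ = r ^ k := by ring
  · exact ae_of_all _ fun _ _ => hs
  · exact intervalIntegrable_const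
  · refine ae_of_all _ fun θ _ => ?_
    convert! (hasSum_log_norm_one_sub hr0 hr1 (a * θ)).mul_right (cos (2 * π * (l * θ))) using 2
      with k
    push_cast
    ring_nf

theorem tendsto_integral_log_norm_one_sub {a : ℕ} (ha : 0 < a) (l : ℕ) :
    Tendsto (fun r : ℝ => ∫ θ in (0 : ℝ)..1, -log ‖1 - r * e (a * θ)‖ * cos (2 * π * (l * θ)))
      (𝓝[<] 1) (𝓝 (∫ θ in (0 : ℝ)..1, -logKernel (a * θ) * cos (2 * π * (l * θ)))) := by
  have hr : ∀ᶠ r : ℝ in 𝓝[<] 1, 0 ≤ r ∧ r ≤ 1 := by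
    filter_upwards [Ioo_mem_nhdsLT (show (0 : ℝ) < 1 by norm_num)] with r hr
    exact ⟨hr.1.le, hr.2.le⟩
  have hce := continuous_e
  refine intervalIntegral.tendsto_integral_filter_of_dominated_convergence
    (fun θ => log 2 + |logKernel (a * θ)|) ?_ ?_ ?_ ?_
  · refine Eventually.of_forall fun r => ?_
    refine Measurable.aestronglyMeasurable ?_
    refine Measurable.mul (Measurable.neg (measurable_log.comp ?_)) ?_
    · exact Continuous.measurable (by fun_prop)
    · exact Continuous.measurable (by fun_prop)
  · filter_upwards [hr] with r hr
    filter_upwards [ae_e_mul_ne_one ha] with θ hθ _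
    rw [norm_mul, norm_neg, Real.norm_eq_abs, Real.norm_eq_abs]
    calc _ ≤ (log 2 + |log ‖1 - e (a * θ)‖|) * 1 := by
          gcongr
          · exact abs_log_norm_one_sub_le (norm_e _) hθ hr.1 hr.2
          · exact abs_cos_le_one _
      _ = _ := by rw [mul_one]; rfl
  · exact intervalIntegrable_const.add (intervalIntegrable_logKernel_mul a).abs
  · filter_upwards [ae_e_mul_ne_one ha] with θ hθ _
    have hne : ‖1 - ((1 : ℝ) : ℂ) * e (a * θ)‖ ≠ 0 := by
      rw [Complex.ofReal_one, one_mul]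
      exact norm_ne_zero_iff.2 (sub_ne_zero.2 hθ.symm)
    have hc : ContinuousAt (fun r : ℝ => -log ‖1 - r * e (a * θ)‖ * cos (2 * π * (l * θ))) 1 := by
      refine ContinuousAt.mul (ContinuousAt.neg (ContinuousAt.log ?_ hne)) continuousAt_const
      fun_prop
    have := hc.tendsto.mono_left (nhdsWithin_le_nhds (s := Set.Iio 1))
    simpa [logKernel] using this

theorem cos_correlation_nonneg (k l : ℤ) :
    0 ≤ ∫ θ in (0 : ℝ)..1, cos (2 * π * (k * θ)) * cos (2 * π * (l * θ)) := by
  rw [integral_cos_mul_cos]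
  split_ifs <;> norm_num

/-- All Fourier coefficients of `-log |1 - e(aθ)|` are nonnegative. -/
theorem fourier_logKernel_nonneg {a : ℕ} (ha : 0 < a) (l : ℕ) :
    0 ≤ ∫ θ in (0 : ℝ)..1, -logKernel (a * θ) * cos (2 * π * (l * θ)) := by
  refine ge_of_tendsto (tendsto_integral_log_norm_one_sub ha l) ?_
  filter_upwards [Ioo_mem_nhdsLT (show (0 : ℝ) < 1 by norm_num)] with r hr
  refine (hasSum_integral_log_norm_one_sub hr.1.le hr.2 a l).nonneg fun k => ?_
  have hr0 := hr.1.le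
  have := cos_correlation_nonneg (k * a) l
  positivity

/-- The Fourier coefficient of `-log |1 - e(aθ)|` at its basic frequency `a`. -/
theorem half_le_fourier_logKernel {a : ℕ} (ha : 0 < a) :
    1 / 2 ≤ ∫ θ in (0 : ℝ)..1, -logKernel (a * θ) * cos (2 * π * (a * θ)) := by
  have hlim : Tendsto (fun r : ℝ => r / 2) (𝓝[<] 1) (𝓝 (1 / 2)) :=
    (Continuous.tendsto (by fun_prop) 1).mono_left nhdsWithin_le_nhds
  refine le_of_tendsto_of_tendsto hlim (tendsto_integral_log_norm_one_sub ha a) ?_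
  filter_upwards [Ioo_mem_nhdsLT (show (0 : ℝ) < 1 by norm_num)] with r hr
  have hr0 := hr.1.le
  have h := le_hasSum (hasSum_integral_log_norm_one_sub hr0 hr.2 a a) 1 fun k _ => by
    have := cos_correlation_nonneg (k * a) a
    positivity
  refine le_trans (le_of_eq ?_) h
  have h2 := integral_cos_mul_cos ((1 : ℕ) * a) a
  have h3 : (a : ℤ) + a ≠ 0 := by positivity
  rw [h2]
  simp only [Nat.cast_one, one_mul, sub_self, h3, if_true, if_false]
  ring

theorem integral_logKernel_mul {a : ℕ} (ha : 0 < a) :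
    ∫ θ in (0 : ℝ)..1, logKernel (a * θ) = 0 := by
  have h := tendsto_integral_log_norm_one_sub ha 0
  have h0 : ∀ᶠ r : ℝ in 𝓝[<] 1,
      ∫ θ in (0 : ℝ)..1, -log ‖1 - r * e (a * θ)‖ * cos (2 * π * ((0 : ℕ) * θ)) = 0 := by
    filter_upwards [Ioo_mem_nhdsLT (show (0 : ℝ) < 1 by norm_num)] with r hr
    refine (hasSum_integral_log_norm_one_sub hr.1.le hr.2 a 0).unique ?_
    convert! hasSum_zero using 2 with k
    rcases Nat.eq_zero_or_pos k with rfl | hk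
    · simp
    · have : (k : ℤ) * a ≠ 0 := by positivity
      rw [integral_cos_mul_cos]
      simp [hk.ne', ha.ne']
  have h1 := tendsto_nhds_unique h (tendsto_const_nhds.congr' (h0.mono fun r hr => hr.symm))
  simpa using h1

/-! ### Riesz products and exponential moments of dissociated cosine sums -/

theorem exp_mul_le_cosh_add_sinh_mul (t : ℝ) {x : ℝ} (h1 : -1 ≤ x) (h2 : x ≤ 1) :
    exp (t * x) ≤ cosh t + sinh t * x := by
  have h := convexOn_exp.2 (Set.mem_univ t) (Set.mem_univ (-t))
    (show 0 ≤ (1 + x) / 2 by linarith) (show 0 ≤ (1 - x) / 2 by linarith) (by ring)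
  simp only [smul_eq_mul] at h
  rw [cosh_eq, sinh_eq]
  calc exp (t * x) = exp ((1 + x) / 2 * t + (1 - x) / 2 * -t) := by ring_nf
    _ ≤ _ := h
    _ = _ := by ring

theorem prod_two_mul_cos {ι : Type*} [DecidableEq ι] (S : Finset ι) (φ : ι → ℝ) :
    ∏ i ∈ S, 2 * cos (φ i) =
      ∑ T ∈ S.powerset, cos (∑ i ∈ T, φ i - ∑ i ∈ S \ T, φ i) := by
  have h : ((∏ i ∈ S, 2 * cos (φ i) : ℝ) : ℂ) =
      ∑ T ∈ S.powerset, Complex.exp ((∑ i ∈ T, φ i - ∑ i ∈ S \ T, φ i : ℝ) * Complex.I) := by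
    push_cast
    simp_rw [Complex.two_cos, Finset.prod_add, ← Complex.exp_sum, ← Complex.exp_add]
    refine Finset.sum_congr rfl fun T _ => ?_
    congr 1
    simp_rw [sub_mul, Finset.sum_mul, neg_mul, Finset.sum_neg_distrib]
    ring
  have := congrArg Complex.re h
  simpa only [Complex.ofReal_re, Complex.re_sum, Complex.exp_ofReal_mul_I_re] using this

theorem IsDissociated.sum_sub_sum_ne_zero {D S T : Finset ℤ} (hD : IsDissociated D)
    (hS : S ⊆ D) (hT : T ⊆ S) (hne : S.Nonempty) :
    ∑ d ∈ T, d - ∑ d ∈ S \ T, d ≠ 0 := by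
  intro h0
  obtain ⟨s, hs⟩ := hne
  have h := hD (fun d => if d ∈ S then (if d ∈ T then 1 else -1) else 0)
    (fun d _ => by grind) ?_ s (hS hs)
  · simp only [hs, if_true] at h
    grind
  · refine Eq.trans ?_ h0
    rw [← Finset.sum_subset hS (fun d _ hd => by simp [hd]), ← Finset.sum_sdiff hT, add_comm,
      sub_eq_add_neg, ← Finset.sum_neg_distrib]
    congr 1
    · refine Finset.sum_congr rfl fun d hd => ?_
      simp [hd, hT hd]
    · refine Finset.sum_congr rfl fun d hd => ?_
      rw [Finset.mem_sdiff] at hd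
      simp [hd.1, hd.2]

theorem IsDissociated.integral_prod_cos {D S : Finset ℤ} (hD : IsDissociated D)
    (hS : S ⊆ D) (hne : S.Nonempty) :
    ∫ θ in (0 : ℝ)..1, ∏ d ∈ S, cos (2 * π * (d * θ)) = 0 := by
  have h : ∀ θ : ℝ, ∏ d ∈ S, cos (2 * π * (d * θ)) = (∏ d ∈ S, (1 / 2 : ℝ)) *
      ∑ T ∈ S.powerset, cos (2 * π * ((∑ d ∈ T, d - ∑ d ∈ S \ T, d : ℤ) * θ)) := by
    intro θ
    have h1 := prod_two_mul_cos S fun d : ℤ => 2 * π * (d * θ)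
    simp_rw [← Finset.mul_sum, ← Finset.sum_mul] at h1
    have h2 : ∏ d ∈ S, cos (2 * π * (d * θ)) =
        (∏ d ∈ S, (1 / 2 : ℝ)) * ∏ d ∈ S, 2 * cos (2 * π * (d * θ)) := by
      rw [← Finset.prod_mul_distrib]
      exact Finset.prod_congr rfl fun d _ => by ring
    rw [h2, h1]
    push_cast
    congr 1
    exact Finset.sum_congr rfl fun T _ => by ring_nf
  simp_rw [h]
  rw [intervalIntegral.integral_const_mul, intervalIntegral.integral_finsetSum]
  · rw [Finset.sum_eq_zero, mul_zero]
    intro T hT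
    rw [integral_cos_int, if_neg (hD.sum_sub_sum_ne_zero hS (Finset.mem_powerset.1 hT) hne)]
  · intro T _
    exact Continuous.intervalIntegrable (by fun_prop) _ _

/-- The mean of the Riesz product `∏ (u + v cos (2πdθ))` over a dissociated set is its constant
term. -/
theorem IsDissociated.integral_riesz {D : Finset ℤ} (hD : IsDissociated D) (u v : ℝ) :
    ∫ θ in (0 : ℝ)..1, ∏ d ∈ D, (u + v * cos (2 * π * (d * θ))) = u ^ D.card := by
  have h : ∀ θ : ℝ, ∏ d ∈ D, (u + v * cos (2 * π * (d * θ))) =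
      ∑ S ∈ D.powerset, v ^ S.card * u ^ (D \ S).card * ∏ d ∈ S, cos (2 * π * (d * θ)) := by
    intro θ
    simp_rw [add_comm u]
    rw [Finset.prod_add]
    refine Finset.sum_congr rfl fun S _ => ?_
    rw [Finset.prod_mul_distrib, Finset.prod_const, Finset.prod_const]
    ring
  simp_rw [h]
  rw [intervalIntegral.integral_finsetSum, Finset.sum_eq_single ∅]
  · simp
  · intro S hS hne
    rw [intervalIntegral.integral_const_mul, hD.integral_prod_cos (Finset.mem_powerset.1 hS)
      (Finset.nonempty_iff_ne_empty.2 hne), mul_zero]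
  · simp
  · intro S _
    exact Continuous.intervalIntegrable (by fun_prop) _ _

/-- The cosine polynomial `∑_{d ∈ D} cos (2πdθ)` with spectrum `D`. -/
noncomputable def cosSum (D : Finset ℤ) (θ : ℝ) : ℝ := ∑ d ∈ D, cos (2 * π * (d * θ))

theorem continuous_cosSum (D : Finset ℤ) : Continuous (cosSum D) := by
  unfold cosSum
  fun_prop

theorem abs_cosSum_le (D : Finset ℤ) (θ : ℝ) : |cosSum D θ| ≤ D.card := by
  calc |cosSum D θ| ≤ ∑ d ∈ D, |cos (2 * π * (d * θ))| := Finset.abs_sum_le_sum_abs _ _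
    _ ≤ ∑ d ∈ D, (1 : ℝ) := Finset.sum_le_sum fun d _ => abs_cos_le_one _
    _ = D.card := by simp

/-- Cosine sums over a dissociated set are subgaussian: they are dominated by a Riesz product. -/
theorem IsDissociated.integral_exp_cosSum_le {D : Finset ℤ} (hD : IsDissociated D) (t : ℝ) :
    ∫ θ in (0 : ℝ)..1, exp (t * cosSum D θ) ≤ exp (D.card * t ^ 2 / 2) := by
  have hc := continuous_cosSum D
  calc ∫ θ in (0 : ℝ)..1, exp (t * cosSum D θ)
      ≤ ∫ θ in (0 : ℝ)..1, ∏ d ∈ D, (cosh t + sinh t * cos (2 * π * (d * θ))) := by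
        refine intervalIntegral.integral_mono zero_le_one
          (Continuous.intervalIntegrable (by fun_prop) _ _)
          (Continuous.intervalIntegrable (by fun_prop) _ _) fun θ => ?_
        simp only [cosSum, Finset.mul_sum, exp_sum]
        exact Finset.prod_le_prod (fun _ _ => (exp_pos _).le) fun d _ =>
          exp_mul_le_cosh_add_sinh_mul t (neg_one_le_cos _) (cos_le_one _)
    _ = cosh t ^ D.card := hD.integral_riesz _ _
    _ ≤ exp (t ^ 2 / 2) ^ D.card := by
        gcongr
        exact cosh_le_exp_half_sq t
    _ = exp (D.card * t ^ 2 / 2) := by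
        rw [← exp_nat_mul]
        ring_nf

theorem isDissociated_singleton {d : ℤ} (hd : d ≠ 0) : IsDissociated {d} := by
  intro ε _ h
  simpa [hd] using h

/-! ### The `L¹` norm of `logSum` -/

section

variable {n : ℕ} {a : Fin n → ℕ}

theorem logSum_eq (a : Fin n → ℕ) (θ : ℝ) : logSum a θ = ∑ j, logKernel (a j * θ) := rfl

theorem intervalIntegrable_logSum (a : Fin n → ℕ) :
    IntervalIntegrable (logSum a) volume 0 1 := by
  have := IntervalIntegrable.sum (μ := volume) (a := 0) (b := 1) Finset.univ
    (f := fun j θ => logKernel (a j * θ)) fun j _ => intervalIntegrable_logKernel_mul (a j)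
  convert! this using 1
  ext θ
  simp [logSum_eq]

theorem integral_logSum (ha : ∀ i, 0 < a i) : ∫ θ in (0 : ℝ)..1, logSum a θ = 0 := by
  simp_rw [logSum_eq]
  rw [intervalIntegral.integral_finsetSum fun j _ => intervalIntegrable_logKernel_mul (a j)]
  exact Finset.sum_eq_zero fun j _ => integral_logKernel_mul (ha j)

theorem half_le_fourier_logSum (ha : ∀ i, 0 < a i) (i : Fin n) :
    1 / 2 ≤ ∫ θ in (0 : ℝ)..1, -logSum a θ * cos (2 * π * (a i * θ)) := by
  have h : ∀ θ, -logSum a θ * cos (2 * π * (a i * θ)) =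
      ∑ j, -logKernel (a j * θ) * cos (2 * π * (a i * θ)) := by
    intro θ
    rw [logSum_eq, ← Finset.sum_neg_distrib, Finset.sum_mul]
  simp_rw [h]
  have hint : ∀ j ∈ (Finset.univ : Finset (Fin n)), IntervalIntegrable
      (fun θ => -logKernel (a j * θ) * cos (2 * π * (a i * θ))) volume 0 1 := fun j _ =>
    (intervalIntegrable_logKernel_mul (a j)).neg.mul_continuousOn
      (Continuous.continuousOn (by fun_prop))
  rw [intervalIntegral.integral_finsetSum hint]
  exact (half_le_fourier_logKernel (ha i)).trans
    (Finset.single_le_sum (fun j _ => fourier_logKernel_nonneg (ha j) (a i)) (Finset.mem_univ i))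

theorem half_card_le_integral_logSum_mul_cosSum (ha : ∀ i, 0 < a i) {D : Finset ℤ}
    (hD : (D : Set ℤ) ⊆ Set.range fun i => (a i : ℤ)) :
    (D.card : ℝ) / 2 ≤ ∫ θ in (0 : ℝ)..1, -logSum a θ * cosSum D θ := by
  simp_rw [cosSum, Finset.mul_sum]
  have hint : ∀ d ∈ D, IntervalIntegrable
      (fun θ => -logSum a θ * cos (2 * π * (d * θ))) volume 0 1 := fun d _ =>
    (intervalIntegrable_logSum a).neg.mul_continuousOn (Continuous.continuousOn (by fun_prop))
  rw [intervalIntegral.integral_finsetSum hint]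
  calc (D.card : ℝ) / 2 = ∑ d ∈ D, (1 / 2 : ℝ) := by simp; ring
    _ ≤ _ := Finset.sum_le_sum fun d hd => by
      obtain ⟨i, rfl⟩ := hD hd
      exact half_le_fourier_logSum ha i

/-- Truncating `P` at height `L`: where `|P| ≤ L` the product `|F P|` is at most `L |F|`, and
elsewhere the exponential factor exceeds `1`, while `|y| ≤ η y² / 2 + 1 / (2η)`. -/
theorem abs_sum_mul_le {ι : Type*} (s : Finset ι) (y : ι → ℝ) {P m L η t : ℝ} (hP : |P| ≤ m)
    (hL : 0 ≤ L) (hη : 0 < η) (ht : 0 ≤ t) :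
    |∑ j ∈ s, y j| * |P| ≤ L * |∑ j ∈ s, y j| +
      m * ∑ j ∈ s, (η / 2 * y j ^ 2 +
        1 / (2 * η) * (exp (-(t * L)) * (exp (t * P) + exp (-t * P)))) := by
  have hm : 0 ≤ m := (abs_nonneg P).trans hP
  rcases le_total |P| L with h | h
  · have h1 : |∑ j ∈ s, y j| * |P| ≤ L * |∑ j ∈ s, y j| := by
      rw [mul_comm]
      gcongr
    have h2 : 0 ≤ m * ∑ j ∈ s, (η / 2 * y j ^ 2 +
        1 / (2 * η) * (exp (-(t * L)) * (exp (t * P) + exp (-t * P)))) := by positivity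
    linarith
  · have hexp : 1 ≤ exp (-(t * L)) * (exp (t * P) + exp (-t * P)) := by
      have h1 : exp (t * L) ≤ exp (t * P) + exp (-t * P) := by
        rcases abs_cases P with ⟨hc, _⟩ | ⟨hc, _⟩
        · have : exp (t * L) ≤ exp (t * P) := exp_le_exp.2 (by gcongr; linarith)
          linarith [exp_pos (-t * P)]
        · have : exp (t * L) ≤ exp (-t * P) := exp_le_exp.2 (by rw [neg_mul_comm]; gcongr; linarith)
          linarith [exp_pos (t * P)]
      rw [exp_neg, inv_mul_eq_div, one_le_div (exp_pos _)]
      exact h1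
    have hy : ∀ x : ℝ, |x| ≤ η / 2 * x ^ 2 +
        1 / (2 * η) * (exp (-(t * L)) * (exp (t * P) + exp (-t * P))) := by
      intro x
      have h1 : |x| ≤ η / 2 * x ^ 2 + 1 / (2 * η) := by
        have h2 : η / 2 * x ^ 2 + 1 / (2 * η) - |x| = (η * |x| - 1) ^ 2 / (2 * η) := by
          rw [← sq_abs x]
          field_simp
          ring
        have : 0 ≤ (η * |x| - 1) ^ 2 / (2 * η) := by positivity
        linarith
      have h3 : 1 / (2 * η) * 1 ≤
          1 / (2 * η) * (exp (-(t * L)) * (exp (t * P) + exp (-t * P))) := by gcongr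
      linarith
    have h1 : |∑ j ∈ s, y j| * |P| ≤ m * ∑ j ∈ s, |y j| := by
      rw [mul_comm]
      gcongr
      exact Finset.abs_sum_le_sum_abs _ _
    have h2 : m * ∑ j ∈ s, |y j| ≤ m * ∑ j ∈ s, (η / 2 * y j ^ 2 +
        1 / (2 * η) * (exp (-(t * L)) * (exp (t * P) + exp (-t * P)))) := by
      gcongr with j
      exact hy _
    have : 0 ≤ L * |∑ j ∈ s, y j| := by positivity
    linarith

/-- The duality inequality before the choice of the truncation height `L` and of the parameters
`η` and `t`. -/
theorem half_card_le (ha : ∀ i, 0 < a i) {D : Finset ℤ}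
    (hD : (D : Set ℤ) ⊆ Set.range fun i => (a i : ℤ)) (hdis : IsDissociated D)
    {L η t : ℝ} (hL : 0 ≤ L) (hη : 0 < η) (ht : 0 ≤ t) :
    (D.card : ℝ) / 2 ≤ L * (∫ θ in (0 : ℝ)..1, |logSum a θ|) +
      D.card * (n * (η / 2 * (∫ θ in (0 : ℝ)..1, logKernel θ ^ 2) +
        1 / η * exp (D.card * t ^ 2 / 2 - t * L))) := by
  have hcP := continuous_cosSum D
  have hF := intervalIntegrable_logSum a
  have hexp : ∀ s : ℝ, IntervalIntegrable (fun θ => exp (s * cosSum D θ)) volume 0 1 := fun s =>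
    Continuous.intervalIntegrable (by fun_prop) _ _
  have hE : IntervalIntegrable (fun θ => 1 / (2 * η) * (exp (-(t * L)) *
      (exp (t * cosSum D θ) + exp (-t * cosSum D θ)))) volume 0 1 :=
    Continuous.intervalIntegrable (by fun_prop) _ _
  have hterm : ∀ j ∈ (Finset.univ : Finset (Fin n)), IntervalIntegrable
      (fun θ => η / 2 * logKernel (a j * θ) ^ 2 + 1 / (2 * η) * (exp (-(t * L)) *
        (exp (t * cosSum D θ) + exp (-t * cosSum D θ)))) volume 0 1 := fun j _ =>
    ((intervalIntegrable_logKernel_mul_sq (a j)).const_mul _).add hE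
  have hsum : IntervalIntegrable (fun θ => ∑ j, (η / 2 * logKernel (a j * θ) ^ 2 + 1 / (2 * η) *
      (exp (-(t * L)) * (exp (t * cosSum D θ) + exp (-t * cosSum D θ))))) volume 0 1 := by
    have := IntervalIntegrable.sum Finset.univ hterm
    convert! this using 1
    ext θ
    simp
  have hterm_le : ∀ j : Fin n, ∫ θ in (0 : ℝ)..1, (η / 2 * logKernel (a j * θ) ^ 2 + 1 / (2 * η) *
      (exp (-(t * L)) * (exp (t * cosSum D θ) + exp (-t * cosSum D θ)))) ≤
      η / 2 * (∫ θ in (0 : ℝ)..1, logKernel θ ^ 2) +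
        1 / η * exp (D.card * t ^ 2 / 2 - t * L) := by
    intro j
    rw [intervalIntegral.integral_add ((intervalIntegrable_logKernel_mul_sq (a j)).const_mul _) hE,
      intervalIntegral.integral_const_mul, intervalIntegral.integral_const_mul,
      intervalIntegral.integral_const_mul, intervalIntegral.integral_add (hexp t) (hexp (-t)),
      integral_logKernel_mul_sq (ha j)]
    have h1 := hdis.integral_exp_cosSum_le t
    have h2 := hdis.integral_exp_cosSum_le (-t)
    rw [neg_sq] at h2
    have h3 : 1 / η * exp (D.card * t ^ 2 / 2 - t * L) = 1 / (2 * η) * (exp (-(t * L)) *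
        (exp (D.card * t ^ 2 / 2) + exp (D.card * t ^ 2 / 2))) := by
      rw [sub_eq_add_neg, exp_add]
      field_simp
      ring
    rw [h3]
    gcongr
  calc (D.card : ℝ) / 2 ≤ ∫ θ in (0 : ℝ)..1, -logSum a θ * cosSum D θ :=
        half_card_le_integral_logSum_mul_cosSum ha hD
    _ ≤ ∫ θ in (0 : ℝ)..1, (L * |logSum a θ| + D.card * ∑ j, (η / 2 * logKernel (a j * θ) ^ 2 +
          1 / (2 * η) * (exp (-(t * L)) *
            (exp (t * cosSum D θ) + exp (-t * cosSum D θ))))) := by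
        refine intervalIntegral.integral_mono zero_le_one
          (hF.neg.mul_continuousOn hcP.continuousOn)
          ((hF.abs.const_mul L).add (hsum.const_mul _)) fun θ => ?_
        calc -logSum a θ * cosSum D θ ≤ |-logSum a θ * cosSum D θ| := le_abs_self _
          _ = |logSum a θ| * |cosSum D θ| := by rw [abs_mul, abs_neg]
          _ ≤ _ := abs_sum_mul_le Finset.univ (fun j => logKernel (a j * θ))
            (abs_cosSum_le D θ) hL hη ht
    _ = L * (∫ θ in (0 : ℝ)..1, |logSum a θ|) + D.card * ∑ j, ∫ θ in (0 : ℝ)..1,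
          (η / 2 * logKernel (a j * θ) ^ 2 + 1 / (2 * η) * (exp (-(t * L)) *
            (exp (t * cosSum D θ) + exp (-t * cosSum D θ)))) := by
        rw [intervalIntegral.integral_add (hF.abs.const_mul L) (hsum.const_mul _),
          intervalIntegral.integral_const_mul, intervalIntegral.integral_const_mul,
          intervalIntegral.integral_finsetSum hterm]
    _ ≤ L * (∫ θ in (0 : ℝ)..1, |logSum a θ|) + D.card * ∑ j : Fin n,
          (η / 2 * (∫ θ in (0 : ℝ)..1, logKernel θ ^ 2) +
            1 / η * exp (D.card * t ^ 2 / 2 - t * L)) := by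
        gcongr with j
        exact hterm_le j
    _ = _ := by rw [Finset.sum_const, Finset.card_univ, Fintype.card_fin, nsmul_eq_mul]

/-- The main estimate: `∫ |F| ≥ c (m / log n)^{1/2}` whenever the frequencies contain a nonempty
dissociated set of size `m`. -/
theorem exists_le_integral_abs_logSum :
    ∃ c : ℝ, 0 < c ∧ ∀ (n : ℕ) (a : Fin n → ℕ) (D : Finset ℤ), 2 ≤ n → (∀ i, 0 < a i) →
      (D : Set ℤ) ⊆ Set.range (fun i => (a i : ℤ)) → IsDissociated D → D.Nonempty →
        c * (√D.card / √(log n)) ≤ ∫ θ in (0 : ℝ)..1, |logSum a θ| := by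
  set K := ∫ θ in (0 : ℝ)..1, logKernel θ ^ 2 with hK
  have hK0 : 0 ≤ K := intervalIntegral.integral_nonneg zero_le_one fun _ _ => sq_nonneg _
  have hlog2 : 0 < log 2 := log_pos one_lt_two
  -- `T` is chosen so that `n ^ (2 - T) ≤ 1 / (32 (K + 1))` for all `n ≥ 2`.
  set T := 2 + 32 * (K + 1) / log 2 with hT
  have hT0 : 0 < T := by positivity
  refine ⟨1 / (4 * √(2 * T)), by positivity, fun n a D hn ha hD hdis hne => ?_⟩
  set m : ℝ := (D.card : ℝ) with hm
  have hm0 : 0 < m := by simpa [hm] using hne.card_pos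
  have hn2 : (2 : ℝ) ≤ n := by exact_mod_cast hn
  have hn0 : (0 : ℝ) < n := by linarith
  have hlog : log 2 ≤ log n := log_le_log two_pos hn2
  have hlogn : 0 < log n := hlog2.trans_le hlog
  set L := √(2 * T * m * log n) with hL
  have hL0 : 0 < L := sqrt_pos.2 (by positivity)
  have hLsq : L ^ 2 = 2 * T * m * log n := sq_sqrt (by positivity)
  -- `t = L / m` minimizes `m t² / 2 - t L`; this `η` makes the `L²` term at most `m / 8`.
  have h := half_card_le ha hD hdis (L := L) (η := 1 / (4 * (K + 1) * n)) (t := L / m) hL0.le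
    (by positivity) (by positivity)
  rw [← hm, ← hK] at h
  have h1 : m * (L / m) ^ 2 / 2 - L / m * L = -(T * log n) := by
    have : m * (L / m) ^ 2 / 2 - L / m * L = -(L ^ 2 / (2 * m)) := by field_simp; ring
    rw [this, hLsq]
    field_simp
  have h2 : exp (-(T * log n)) ≤ 1 / (32 * (K + 1) * n ^ 2) := by
    have h3 : 32 * (K + 1) * (n : ℝ) ^ 2 ≤ exp (T * log n) := by
      have h4 : T * log n = 32 * (K + 1) / log 2 * log n + (log n + log n) := by rw [hT]; ring
      have h5 : 32 * (K + 1) ≤ 32 * (K + 1) / log 2 * log n := by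
        rw [div_mul_eq_mul_div, le_div_iff₀ hlog2]
        gcongr
      rw [h4, exp_add, exp_add, exp_log hn0, ← sq]
      gcongr
      have := add_one_le_exp (32 * (K + 1) / log 2 * log n)
      linarith
    rw [exp_neg, ← one_div]
    gcongr
  have h3 : (n : ℝ) * (1 / (4 * (K + 1) * n) / 2 * K +
      1 / (1 / (4 * (K + 1) * n)) * exp (m * (L / m) ^ 2 / 2 - L / m * L)) ≤ 1 / 4 := by
    rw [h1]
    calc _ ≤ (n : ℝ) * (1 / (4 * (K + 1) * n) / 2 * (K + 1) +
          1 / (1 / (4 * (K + 1) * n)) * (1 / (32 * (K + 1) * n ^ 2))) := by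
          gcongr
          linarith
      _ = 1 / 4 := by field_simp; norm_num
  have h4 : m / 4 ≤ L * ∫ θ in (0 : ℝ)..1, |logSum a θ| := by
    have := mul_le_mul_of_nonneg_left h3 hm0.le
    linarith
  have h5 : L = √(2 * T) * √m * √(log n) := by
    rw [hL, sqrt_mul (by positivity), sqrt_mul (by positivity)]
  have h6 : 1 / (4 * √(2 * T)) * (√m / √(log n)) = m / 4 / L := by
    rw [h5]
    have : m = √m * √m := (mul_self_sqrt hm0.le).symm
    have hs : 0 < √m := sqrt_pos.2 hm0
    have hs2 : 0 < √(log n) := sqrt_pos.2 hlogn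
    have hs3 : 0 < √(2 * T) := sqrt_pos.2 (by positivity)
    nth_rw 2 [this]
    field_simp
  rw [h6, div_le_iff₀ hL0, mul_comm]
  exact h4

/-! ### From the `L¹` norm to the maximum -/

theorem prod_le_maxProd (a : Fin n → ℕ) (θ : ℝ) : ∏ i, ‖1 - e (a i * θ)‖ ≤ maxProd a :=
  (isGreatest_maxProd a).2 ⟨e θ, norm_e θ, by simp only [e_pow]⟩

/-- The inequality may fail at zeros of the product, where `log 0 = 0` makes `logSum` too large. -/
theorem ae_logSum_le (ha : ∀ i, 0 < a i) :
    ∀ᵐ θ : ℝ, 0 < maxProd a ∧ logSum a θ ≤ log (maxProd a) := by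
  filter_upwards [ae_all_iff.2 fun i => ae_e_mul_ne_one (ha i)] with θ hθ
  have hne : ∀ i, ‖1 - e (a i * θ)‖ ≠ 0 := fun i =>
    norm_ne_zero_iff.2 (sub_ne_zero.2 (hθ i).symm)
  have hpos : 0 < ∏ i, ‖1 - e (a i * θ)‖ :=
    Finset.prod_pos fun i _ => (norm_nonneg _).lt_of_ne' (hne i)
  refine ⟨hpos.trans_le (prod_le_maxProd a θ), ?_⟩
  rw [logSum, ← log_prod fun i _ => hne i]
  exact log_le_log hpos (prod_le_maxProd a θ)

theorem maxProd_pos (ha : ∀ i, 0 < a i) : 0 < maxProd a :=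
  let ⟨_, h, _⟩ := (ae_logSum_le ha).exists
  h

/-- Since `F` has mean zero, `∫ |F| = 2 ∫ F⁺`. -/
theorem integral_abs_logSum_le (ha : ∀ i, 0 < a i) :
    ∫ θ in (0 : ℝ)..1, |logSum a θ| ≤ 2 * log (maxProd a) := by
  have hF := intervalIntegrable_logSum a
  have h0 : 0 ≤ log (maxProd a) := by
    have := intervalIntegral.integral_mono_ae zero_le_one hF
      (intervalIntegrable_const (c := log (maxProd a)))
      ((ae_logSum_le ha).mono fun θ hθ => hθ.2)
    simpa [integral_logSum ha] using this
  calc ∫ θ in (0 : ℝ)..1, |logSum a θ| = ∫ θ in (0 : ℝ)..1, (|logSum a θ| + logSum a θ) := by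
        rw [intervalIntegral.integral_add hF.abs hF, integral_logSum ha, add_zero]
    _ ≤ ∫ θ in (0 : ℝ)..1, 2 * log (maxProd a) := by
        refine intervalIntegral.integral_mono_ae zero_le_one (hF.abs.add hF)
          intervalIntegrable_const ((ae_logSum_le ha).mono fun θ hθ => ?_)
        rcases abs_cases (logSum a θ) with ⟨h, _⟩ | ⟨h, _⟩ <;> simp only [h] <;> linarith [hθ.2]
    _ = 2 * log (maxProd a) := by simp

end

end ErdosSzekeres

theorem proposition1p3 (ε : ℝ) (hε : 0 < ε) :
    (∃ c : ℝ, 0 < c ∧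
      ∀ (n m : ℕ) (a : Fin n → ℕ) (D : Finset ℤ),
        2 ≤ n → (∀ i, 0 < a i) → StrictMono a →
        (D : Set ℤ) ⊆ Set.range (fun i => (a i : ℤ)) →
        ErdosSzekeres.IsDissociated D → D.card = m →
          c * ((m : ℝ) ^ (1 / 2 - ε) / (Real.log n) ^ (1 / 2 : ℝ)) ≤
              Real.log (ErdosSzekeres.maxProd a) ∧
          c * ((m : ℝ) ^ (1 / 2 - ε) / (Real.log n) ^ (1 / 2 : ℝ)) ≤
              ∫ θ in (0 : ℝ)..1, |ErdosSzekeres.logSum a θ|) ∧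
    (∀ A : ℝ, 0 < A → ∃ C : ℝ, 0 < C ∧
      ∀ (n m : ℕ) (a : Fin n → ℕ) (D : Finset ℤ),
        2 ≤ n → (∀ i, 0 < a i) → StrictMono a →
        (D : Set ℤ) ⊆ Set.range (fun i => (a i : ℤ)) →
        ErdosSzekeres.IsDissociated D → D.card = m →
        C * (Real.log n) ^ (3 + ε) ≤ (m : ℝ) →
          Real.sqrt (2 * n) ^ A < ErdosSzekeres.maxProd a) := by
  obtain ⟨c, hc, hmain⟩ := ErdosSzekeres.exists_le_integral_abs_logSum
  have hlog2 : 0 < log 2 := log_pos one_lt_two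
  constructor
  · refine ⟨c / 2, by positivity, ?_⟩
    rintro n m a D hn ha - hD hdis rfl
    -- The empty set is replaced by a singleton: for `ε = 1 / 2` the convention `0 ^ 0 = 1` makes
    -- the bound nontrivial also for `m = 0`.
    obtain ⟨D', hD', hdis', hne', hcard⟩ : ∃ D' : Finset ℤ,
        (D' : Set ℤ) ⊆ Set.range (fun i => (a i : ℤ)) ∧ ErdosSzekeres.IsDissociated D' ∧
          D'.Nonempty ∧ (D.card : ℝ) ^ (1 / 2 - ε) ≤ √D'.card := by
      rcases D.eq_empty_or_nonempty with rfl | hne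
      · refine ⟨{(a ⟨0, by omega⟩ : ℤ)}, by simp,
          ErdosSzekeres.isDissociated_singleton (by exact_mod_cast (ha _).ne'), by simp, ?_⟩
        simpa using zero_rpow_le_one (1 / 2 - ε)
      · refine ⟨D, hD, hdis, hne, ?_⟩
        rw [sqrt_eq_rpow]
        exact rpow_le_rpow_of_exponent_le (by exact_mod_cast hne.card_pos) (by linarith)
    have hX := hmain n a D' hn ha hD' hdis' hne'
    have hM := ErdosSzekeres.integral_abs_logSum_le ha
    rw [← sqrt_eq_rpow (log n)]
    have h1 : c * ((D.card : ℝ) ^ (1 / 2 - ε) / √(log n)) ≤ c * (√D'.card / √(log n)) := by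
      gcongr
    have h2 : 0 ≤ c * ((D.card : ℝ) ^ (1 / 2 - ε) / √(log n)) := by positivity
    constructor <;> linarith
  · intro A hA
    set δ := (log 2) ^ (ε / 2) with hδ
    have hδ0 : 0 < δ := rpow_pos_of_pos hlog2 _
    -- With this `C` the bound `(c / 2) (m / log n)^{1/2}` is at least `(A + 1) log n`, because
    -- `(log n) ^ (ε / 2) ≥ δ`.
    refine ⟨(2 * (A + 1) / (c * δ)) ^ 2, by positivity, ?_⟩
    rintro n m a D hn ha - hD hdis rfl hm
    have hn2 : (2 : ℝ) ≤ n := by exact_mod_cast hn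
    have hn0 : (0 : ℝ) < n := by linarith
    have hlog : log 2 ≤ log n := log_le_log two_pos hn2
    have hlogn : 0 < log n := hlog2.trans_le hlog
    have hDpos : (0 : ℝ) < D.card := lt_of_lt_of_le (by positivity) hm
    have hne : D.Nonempty := Finset.card_pos.1 (by exact_mod_cast hDpos)
    have hX := (hmain n a D hn ha hD hdis hne).trans (ErdosSzekeres.integral_abs_logSum_le ha)
    have h1 : 2 * (A + 1) / (c * δ) * (δ * (log n * √(log n))) ≤ √D.card := by
      refine le_sqrt_of_sq_le (le_trans ?_ hm)
      rw [mul_pow]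
      gcongr
      have h2 : (log n) ^ (3 + ε) = ((log n) ^ (ε / 2) * (log n * √(log n))) ^ 2 := by
        rw [mul_pow, mul_pow, sq_sqrt hlogn.le, ← rpow_natCast, ← rpow_mul hlogn.le,
          rpow_add hlogn]
        norm_num
        ring
      rw [h2, hδ]
      gcongr
    have h3 : 2 * (A + 1) * log n ≤ c * (√D.card / √(log n)) := by
      have hs : 0 < √(log n) := sqrt_pos.2 hlogn
      calc 2 * (A + 1) * log n
          = c * (2 * (A + 1) / (c * δ) * (δ * (log n * √(log n))) / √(log n)) := by field_simp
        _ ≤ _ := by gcongr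
    have h4 : log (2 * n) ≤ 2 * log n := by
      rw [log_mul two_ne_zero hn0.ne']
      linarith
    have hpos : 0 < √(2 * n) := sqrt_pos.2 (by positivity)
    rw [← log_lt_log_iff (rpow_pos_of_pos hpos _) (ErdosSzekeres.maxProd_pos ha), log_rpow hpos,
      log_sqrt (by positivity)]
    nlinarith
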